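/- Let $d,N\ge 1$ be integers. For $k\ge 1$ and $x_1,\dots,x_k\in\mathbb{R}^d$ put $$c_k(x_1,\dots,x_k)=\sum_{1\le i<j\le k}\frac{1}{|x_i-x_j|}\in[0,+\infty],$$ with the value $+\infty$ if two of the points coincide (and $c_1=0$). For a function $\varphi:\mathbb{R}^d\to\mathbb{R}$ put $$M_k(\varphi)=\sup\Big\{\frac1k\sum_{i=1}^k\varphi(x_i)-c_k(x_1,\dots,x_k)\ :\ x_1,\dots,x_k\in\mathbb{R}^d\Big\},$$ with the convention $M_0=0$. Let $\mathcal P$ be the set of Borel probability measures on $\mathbb{R}^d$ and $\mathcal P^-$ the set of nonnegative Borel measures on $\mathbb{R}^d$ of total mass at most $1$. For $\rho\in\mathcal P$ let $$C(\rho)=\inf\Big\{\int_{(\mathbb{R}^d)^N} c_N\,dP\ :\ P \text{ a Borel probability on } (\mathbb{R}^d)^N \text{ whose } N \text{ marginals on } \mathbb{R}^d \text{ all equal } \rho\Big\},$$ and for $\rho\in\mathcal P^-$ let $$\overline C(\rho)=\inf\Big\{\liminf_{n\to\infty} C(\rho_n)\ :\ \rho_n\in\mathcal P,\ \rho_n\stackrel{*}{\rightharpoonup}\rho\Big\},$$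 where $\rho_n\stackrel{*}{\rightharpoonup}\rho$ means that $\int f\,d\rho_n\to\int f\,d\rho$ for every $f\in C_0$, the space of continuous functions $\mathbb{R}^d\to\mathbb{R}$ vanishing at infinity. Let $V\in C_0$ with $V\ge 0$, and let $\beta=\limsup_{|x|\to\infty}|x|V(x)\in[0,+\infty]$. Assume that $\beta>0$ and $\beta>N(N-1)$. Then $$M_N(V)>M_{N-1}\Big(\frac{N-1}{N}V\Big).$$ In particular, every minimizer of $\rho\mapsto\overline C(\rho)-\int V\,d\rho$ over $\mathcal P^-$ is a probability measure, and the supremum defining $M_N(V)$ is attained at some point of $(\mathbb{R}^d)^N$. -/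

import Mathlib

open MeasureTheory Filter Topology
open scoped ENNReal ZeroAtInfty

noncomputable section

namespace RelaxedCoulomb

variable {d : ℕ}

/-- The Coulomb cost `c_k(x_1, …, x_k) = ∑_{i < j} 1 / |x_i - x_j|` with values in `[0, +∞]`;
it is `+∞` as soon as two of the points coincide. -/
def coulombCost (k : ℕ) (x : Fin k → EuclideanSpace ℝ (Fin d)) : ℝ≥0∞ :=
  ∑ i : Fin k, ∑ j ∈ Finset.Ioi i, (ENNReal.ofReal ‖x i - x j‖)⁻¹

/-- The quantity `(1/k) ∑ φ(x_i) - c_k(x_1, …, x_k)`, with values in `[-∞, +∞)`. -/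
def gain (k : ℕ) (φ : EuclideanSpace ℝ (Fin d) → ℝ)
    (x : Fin k → EuclideanSpace ℝ (Fin d)) : EReal :=
  (((1 / (k : ℝ)) * ∑ i, φ (x i) : ℝ) : EReal) - (coulombCost k x : EReal)

/-- `M_k(φ) = sup {(1/k) ∑ φ(x_i) - c_k(x_1, …, x_k)}`. For `k = 0` this is `0`. -/
def M (k : ℕ) (φ : EuclideanSpace ℝ (Fin d) → ℝ) : EReal :=
  ⨆ x : Fin k → EuclideanSpace ℝ (Fin d), gain k φ x

/-- The probabilities on `(ℝ^d)^N` all of whose `N` marginals are `ρ`. -/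
def transportPlans (N : ℕ) (ρ : Measure (EuclideanSpace ℝ (Fin d))) :
    Set (Measure (Fin N → EuclideanSpace ℝ (Fin d))) :=
  {P | IsProbabilityMeasure P ∧ ∀ i, P.map (fun x => x i) = ρ}

/-- The `N`-marginal Coulomb transport cost `C(ρ)`. -/
def transportCost (N : ℕ) (ρ : Measure (EuclideanSpace ℝ (Fin d))) : ℝ≥0∞ :=
  ⨅ P ∈ transportPlans N ρ, ∫⁻ x, coulombCost N x ∂P

/-- The sub-probabilities on `ℝ^d`: Borel measures of total mass at most `1`. -/
def subProbabilities (d : ℕ) : Set (Measure (EuclideanSpace ℝ (Fin d))) :=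
  {ρ | ρ Set.univ ≤ 1}

/-- Weak* convergence, in duality with the continuous functions vanishing at infinity. -/
def WeakStarTendsto (ρs : ℕ → Measure (EuclideanSpace ℝ (Fin d)))
    (ρ : Measure (EuclideanSpace ℝ (Fin d))) : Prop :=
  ∀ f : C₀(EuclideanSpace ℝ (Fin d), ℝ),
    Tendsto (fun n => ∫ x, f x ∂(ρs n)) atTop (𝓝 (∫ x, f x ∂ρ))

/-- The relaxed cost: the infimum of `liminf C(ρ_n)` over all sequences of probabilities
`ρ_n` that converge weakly* to `ρ`. -/
def relaxedCost (N : ℕ) (ρ : Measure (EuclideanSpace ℝ (Fin d))) : ℝ≥0∞ :=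
  sInf {a | ∃ ρs : ℕ → Measure (EuclideanSpace ℝ (Fin d)),
    (∀ n, IsProbabilityMeasure (ρs n)) ∧ WeakStarTendsto ρs ρ ∧
      a = liminf (fun n => transportCost N (ρs n)) atTop}

/-- The relaxed energy `ρ ↦ relaxedCost ρ - ∫ V dρ`. -/
def relaxedEnergy (N : ℕ) (V : C₀(EuclideanSpace ℝ (Fin d), ℝ))
    (ρ : Measure (EuclideanSpace ℝ (Fin d))) : EReal :=
  (relaxedCost N ρ : EReal) - ((∫ x, V x ∂ρ : ℝ) : EReal)

/-- The set of minimizers of the relaxed energy among all sub-probabilities. -/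
def relaxedMinimizers (N : ℕ) (V : C₀(EuclideanSpace ℝ (Fin d), ℝ)) :
    Set (Measure (EuclideanSpace ℝ (Fin d))) :=
  {ρ | ρ ∈ subProbabilities d ∧ ∀ ρ' ∈ subProbabilities d,
    relaxedEnergy N V ρ ≤ relaxedEnergy N V ρ'}

/-- `limsup_{|x| → ∞} |x| V(x)`, possibly `+∞`. -/
def decayRate (V : C₀(EuclideanSpace ℝ (Fin d), ℝ)) : EReal :=
  limsup (fun x => ((‖x‖ * V x : ℝ) : EReal)) (Bornology.cobounded (EuclideanSpace ℝ (Fin d)))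

end RelaxedCoulomb

end

namespace RelaxedCoulomb

variable {d : ℕ}

/-! With φ = V/N, both suprema in the strict inequality are of the form sup(∑ φ(x_i) - c_k), for k =
N and k = N - 1. A new point y, sent to infinity where |y|V(y) > b > N(N-1), earns more than
b/(N|y|), while its repulsion from N - 1 fixed points is about (N-1)/|y|. So it strictly improves
any maximizer (`exists_cons_totalGain_gt`).

That maximizer comes by induction on k: once k + 1 points beat k points, letting a point escape
brings the value back near the smaller supremum, so the search is confined to a compact set
(`exists_max_totalGain_succ`).

The same confinement rules out mass loss. Configurations leaving a large ball fall short of the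
maximum m by some η > 0, so V - ηf, with f a cutoff of that ball, is a dual potential of level m -
η. Weak duality survives relaxation and gives energy at least -m + η(1 - ∫ f dρ), which exceeds -m
if ρ has mass below 1. The empirical measure of a maximizer has energy at most -m. -/

lemma continuous_coulombCost (k : ℕ) :
    Continuous (coulombCost k : (Fin k → EuclideanSpace ℝ (Fin d)) → ℝ≥0∞) := by
  unfold coulombCost
  refine continuous_finsetSum _ fun i _ => continuous_finsetSum _ fun j _ => ?_
  exact (ENNReal.continuous_ofReal.comp (by fun_prop)).inv

lemma coulombCost_eq_sum_ite (k : ℕ) (x : Fin k → EuclideanSpace ℝ (Fin d)) :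
    coulombCost k x =
      ∑ i, ∑ j, if i < j then (ENNReal.ofReal ‖x i - x j‖)⁻¹ else 0 := by
  unfold coulombCost
  refine Finset.sum_congr rfl fun i _ => ?_
  rw [← Finset.sum_filter]
  congr 1
  ext j
  simp

lemma coulombCost_cons (k : ℕ) (y : EuclideanSpace ℝ (Fin d))
    (x : Fin k → EuclideanSpace ℝ (Fin d)) :
    coulombCost (k + 1) (Fin.cons y x) =
      ∑ j, (ENNReal.ofReal ‖y - x j‖)⁻¹ + coulombCost k x := by
  simp [coulombCost_eq_sum_ite, Fin.sum_univ_succ]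

lemma coulombCost_succAbove_le (k : ℕ) (p : Fin (k + 1))
    (x : Fin (k + 1) → EuclideanSpace ℝ (Fin d)) :
    coulombCost k (fun i => x (p.succAbove i)) ≤ coulombCost (k + 1) x := by
  simp only [coulombCost_eq_sum_ite]
  rw [Fin.sum_univ_succAbove _ p]
  refine le_add_left (Finset.sum_le_sum fun i _ => ?_)
  rw [Fin.sum_univ_succAbove _ p]
  exact le_add_left (by simp)

/-- The sum over ordered pairs makes permutation invariance a mere reindexing. -/
lemma two_mul_coulombCost (k : ℕ) (x : Fin k → EuclideanSpace ℝ (Fin d)) :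
    2 * coulombCost k x =
      ∑ i, ∑ j, if i = j then 0 else (ENNReal.ofReal ‖x i - x j‖)⁻¹ := by
  have hswap : coulombCost k x =
      ∑ i, ∑ j, if j < i then (ENNReal.ofReal ‖x i - x j‖)⁻¹ else 0 := by
    rw [coulombCost_eq_sum_ite, Finset.sum_comm]
    simp only [norm_sub_rev]
  rw [two_mul]
  nth_rewrite 2 [hswap]
  rw [coulombCost_eq_sum_ite]
  simp only [← Finset.sum_add_distrib]
  refine Finset.sum_congr rfl fun i _ => Finset.sum_congr rfl fun j _ => ?_
  rcases lt_trichotomy i j with h | h | h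
  · simp [h, h.ne, h.not_gt]
  · simp [h]
  · simp [h, h.ne', h.not_gt]

lemma coulombCost_comp_equiv (k : ℕ) (σ : Equiv.Perm (Fin k))
    (x : Fin k → EuclideanSpace ℝ (Fin d)) :
    coulombCost k (fun i => x (σ i)) = coulombCost k x := by
  have h : 2 * coulombCost k (fun i => x (σ i)) = 2 * coulombCost k x := by
    rw [two_mul_coulombCost, two_mul_coulombCost,
      ← Equiv.sum_comp σ (fun i => ∑ j, if i = j then 0 else (ENNReal.ofReal ‖x i - x j‖)⁻¹)]
    refine Finset.sum_congr rfl fun i _ => ?_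
    rw [← Equiv.sum_comp σ (fun j => if σ i = j then 0 else (ENNReal.ofReal ‖x (σ i) - x j‖)⁻¹)]
    simp
  exact (ENNReal.mul_right_inj (by simp) (by simp)).1 h

/-! ### Total gain and its elementary properties -/

/-- The total gain `∑ φ(x_i) - c_k(x)`, without the normalizing factor of `gain`. -/
noncomputable def totalGain (k : ℕ) (φ : EuclideanSpace ℝ (Fin d) → ℝ)
    (x : Fin k → EuclideanSpace ℝ (Fin d)) : EReal :=
  ((∑ i, φ (x i) : ℝ) : EReal) - (coulombCost k x : EReal)

/-- For k = 0 the factor 1/k is the default 0, but the sums are empty. -/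
lemma gain_mul_eq_totalGain (k : ℕ) (a b : ℝ) (hab : 1 / (k : ℝ) * a = b ∨ k = 0)
    (V : EuclideanSpace ℝ (Fin d) → ℝ) (x : Fin k → EuclideanSpace ℝ (Fin d)) :
    gain k (fun y => a * V y) x = totalGain k (fun y => b * V y) x := by
  unfold gain totalGain
  congr 2
  rcases hab with h | h
  · rw [← Finset.mul_sum, ← Finset.mul_sum, ← mul_assoc, h]
  · subst h; simp

lemma coe_sub_coe_le_iff (s a : ℝ) (c : ℝ≥0∞) :
    (s : EReal) - (c : EReal) ≤ (a : EReal) ↔ ENNReal.ofReal (s - a) ≤ c := by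
  induction c with
  | top => simp
  | coe c =>
    rw [ENNReal.ofReal_le_iff_le_toReal ENNReal.coe_ne_top]
    change (s : EReal) - ((c : ℝ) : EReal) ≤ a ↔ _
    rw [← EReal.coe_sub, EReal.coe_le_coe_iff, ENNReal.coe_toReal]
    constructor <;> intro h <;> linarith

lemma totalGain_eq_coe {k : ℕ} {φ : EuclideanSpace ℝ (Fin d) → ℝ}
    {x : Fin k → EuclideanSpace ℝ (Fin d)} (hx : coulombCost k x ≠ ⊤) :
    totalGain k φ x = ((∑ i, φ (x i) - (coulombCost k x).toReal : ℝ) : EReal) := by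
  unfold totalGain
  rw [EReal.coe_sub, EReal.coe_ennreal_toReal hx]

lemma coulombCost_ne_top_of_totalGain_eq {k : ℕ} {φ : EuclideanSpace ℝ (Fin d) → ℝ}
    {x : Fin k → EuclideanSpace ℝ (Fin d)} {m : ℝ} (hx : totalGain k φ x = m) :
    coulombCost k x ≠ ⊤ := by
  intro h
  simp [totalGain, h] at hx

lemma continuous_totalGain (k : ℕ) {φ : EuclideanSpace ℝ (Fin d) → ℝ} (hφ : Continuous φ) :
    Continuous (totalGain k φ) := by
  unfold totalGain
  rw [continuous_iff_continuousAt]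
  intro x
  simp only [sub_eq_add_neg]
  have h1 : Continuous fun x : Fin k → EuclideanSpace ℝ (Fin d) =>
      ((∑ i, φ (x i) : ℝ) : EReal) :=
    continuous_coe_real_ereal.comp (by fun_prop)
  have h2 : Continuous fun x : Fin k → EuclideanSpace ℝ (Fin d) =>
      -(coulombCost k x : EReal) :=
    (continuous_coe_ennreal_ereal.comp (continuous_coulombCost k)).neg
  exact ContinuousAt.comp (f := fun x : Fin k → EuclideanSpace ℝ (Fin d) =>
      ((((∑ i, φ (x i) : ℝ) : EReal)), -(coulombCost k x : EReal)))
    (EReal.continuousAt_add (Or.inl (EReal.coe_ne_top _)) (Or.inl (EReal.coe_ne_bot _)))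
    (h1.continuousAt.prodMk h2.continuousAt)

/-- Dropping the point `x p` loses only `φ (x p)`, since the cost can only decrease. -/
lemma totalGain_le_of_succAbove (k : ℕ) {φ : EuclideanSpace ℝ (Fin d) → ℝ} {m : ℝ}
    (hm : ∀ x, totalGain k φ x ≤ m) (p : Fin (k + 1))
    (x : Fin (k + 1) → EuclideanSpace ℝ (Fin d)) :
    totalGain (k + 1) φ x ≤ ((m + φ (x p) : ℝ) : EReal) := by
  have h := (coe_sub_coe_le_iff _ _ _).1 (hm fun i => x (p.succAbove i))
  refine (coe_sub_coe_le_iff _ _ _).2 (le_trans ?_ (h.trans (coulombCost_succAbove_le k p x)))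
  rw [Fin.sum_univ_succAbove _ p]
  exact ENNReal.ofReal_le_ofReal (by linarith)

/-! ### Adding a distant point; existence of maximizers -/

/-- A maximal total gain of `k` points is strictly improved by a further point, placed far away. -/
lemma exists_cons_totalGain_gt {k : ℕ} {φ : EuclideanSpace ℝ (Fin d) → ℝ}
    {c : ℝ} (hc : (k : ℝ) < c)
    (hfreq : ∃ᶠ y in Bornology.cobounded (EuclideanSpace ℝ (Fin d)), c < ‖y‖ * φ y)
    {x : Fin k → EuclideanSpace ℝ (Fin d)} {m : ℝ} (hx : totalGain k φ x = m) :
    ∃ z, (m : EReal) < totalGain (k + 1) φ z := by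
  set R : ℝ := ‖x‖ with hR
  have hR0 : 0 ≤ R := norm_nonneg x
  -- The threshold is chosen so that k/(‖y‖ - R) ≤ c/‖y‖.
  have hev : ∀ᶠ y in Bornology.cobounded (EuclideanSpace ℝ (Fin d)),
      R + c * R / (c - k) + 1 ≤ ‖y‖ :=
    tendsto_norm_cobounded_atTop.eventually_ge_atTop _
  obtain ⟨y, hy, hyR⟩ := (hfreq.and_eventually hev).exists
  have hck : 0 < c - k := sub_pos.2 hc
  have hk0 : (0 : ℝ) ≤ k := k.cast_nonneg
  have hc0 : 0 < c := hk0.trans_lt hc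
  have hq : 0 ≤ c * R / (c - k) := by positivity
  have hyR' : 0 < ‖y‖ - R := by linarith
  have hy0 : 0 < ‖y‖ := by linarith
  have hxc := coulombCost_ne_top_of_totalGain_eq hx
  have hb : ∑ j, (ENNReal.ofReal ‖y - x j‖)⁻¹ ≤ ENNReal.ofReal (k * (‖y‖ - R)⁻¹) := by
    calc ∑ j, (ENNReal.ofReal ‖y - x j‖)⁻¹
        ≤ ∑ _j : Fin k, ENNReal.ofReal (‖y‖ - R)⁻¹ := by
          refine Finset.sum_le_sum fun j _ => ?_
          rw [ENNReal.ofReal_inv_of_pos hyR', ENNReal.inv_le_inv]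
          refine ENNReal.ofReal_le_ofReal ?_
          have h1 := norm_sub_norm_le y (x j)
          have h2 := norm_le_pi_norm x j
          linarith
      _ = ENNReal.ofReal (k * (‖y‖ - R)⁻¹) := by
          rw [Finset.sum_const, Finset.card_univ, Fintype.card_fin, nsmul_eq_mul,
            ENNReal.ofReal_mul hk0, ENNReal.ofReal_natCast]
  have hφ : (k : ℝ) * (‖y‖ - R)⁻¹ < φ y := by
    rw [← div_eq_mul_inv, div_lt_iff₀ hyR']
    have h1 : c * R ≤ (c - k) * ‖y‖ := by
      have : c * R / (c - k) ≤ ‖y‖ := by linarith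
      rwa [div_le_iff₀ hck, mul_comm ‖y‖] at this
    have h2 : c * (‖y‖ - R) < (‖y‖ * φ y) * (‖y‖ - R) := mul_lt_mul_of_pos_right hy hyR'
    have h3 : k * ‖y‖ < ‖y‖ * (φ y * (‖y‖ - R)) := by nlinarith
    rw [mul_comm] at h3
    exact lt_of_mul_lt_mul_left h3 hy0.le
  have hbt : ∑ j, (ENNReal.ofReal ‖y - x j‖)⁻¹ ≠ ⊤ := ne_top_of_le_ne_top ENNReal.ofReal_ne_top hb
  have hb' := ENNReal.toReal_le_of_le_ofReal (by positivity) hb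
  refine ⟨Fin.cons y x, ?_⟩
  rw [totalGain_eq_coe hxc, EReal.coe_eq_coe_iff] at hx
  rw [totalGain_eq_coe (by rw [coulombCost_cons]; exact ENNReal.add_ne_top.2 ⟨hbt, hxc⟩),
    EReal.coe_lt_coe_iff, coulombCost_cons, ENNReal.toReal_add hbt hxc, Fin.sum_univ_succ]
  simp only [Fin.cons_zero, Fin.cons_succ]
  linarith

/-- If the supremum of the total gain is attained for `k` points and is strictly smaller than
the one for `k + 1` points, then the latter is attained, and it is approached only
by bounded configurations. -/
lemma exists_max_totalGain_succ {k : ℕ} {φ : EuclideanSpace ℝ (Fin d) → ℝ} (hφ : Continuous φ)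
    (hφ0 : Tendsto φ (Bornology.cobounded (EuclideanSpace ℝ (Fin d))) (𝓝 0)) {m : ℝ}
    (hm : ∀ x, totalGain k φ x ≤ m) (hlt : ∃ z, (m : EReal) < totalGain (k + 1) φ z) :
    ∃ m' : ℝ, m < m' ∧ (∃ x, totalGain (k + 1) φ x = m') ∧ (∀ x, totalGain (k + 1) φ x ≤ m') ∧
      ∃ η > 0, ∃ R : ℝ, ∀ x : Fin (k + 1) → EuclideanSpace ℝ (Fin d),
        (∃ i, R < ‖x i‖) → totalGain (k + 1) φ x ≤ ((m' - η : ℝ) : EReal) := by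
  obtain ⟨z, hz⟩ := hlt
  have hzc : coulombCost (k + 1) z ≠ ⊤ := by
    intro h
    simp [totalGain, h] at hz
  have hzz := totalGain_eq_coe (φ := φ) hzc
  set a : ℝ := ∑ i, φ (z i) - (coulombCost (k + 1) z).toReal
  rw [hzz, EReal.coe_lt_coe_iff] at hz
  -- Half the gap, so that a configuration with a point where φ < ε gains at most m + ε = a - ε.
  set ε : ℝ := (a - m) / 2 with hε
  have hε0 : 0 < ε := by rw [hε]; linarith
  obtain ⟨R, hR⟩ : ∃ R : ℝ, ∀ y : EuclideanSpace ℝ (Fin d), R < ‖y‖ → φ y < ε := by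
    have h : ∀ᶠ y in Bornology.cobounded (EuclideanSpace ℝ (Fin d)), φ y < ε :=
      hφ0.eventually_lt_const hε0
    rw [Filter.Eventually, Metric.hasBasis_cobounded_compl_closedBall 0 |>.mem_iff] at h
    obtain ⟨R, -, hR⟩ := h
    exact ⟨R, fun y hy => hR (by simpa using hy)⟩
  have hout : ∀ x : Fin (k + 1) → EuclideanSpace ℝ (Fin d),
      (∃ i, R < ‖x i‖) → totalGain (k + 1) φ x ≤ ((a - ε : ℝ) : EReal) := by
    rintro x ⟨i, hi⟩
    refine (totalGain_le_of_succAbove k hm i x).trans (EReal.coe_le_coe_iff.2 ?_)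
    have := hR _ hi
    linarith
  have haε : ((a - ε : ℝ) : EReal) < a := EReal.coe_lt_coe_iff.2 (by linarith)
  have hin : ∀ x : Fin (k + 1) → EuclideanSpace ℝ (Fin d),
      ¬ (∃ i, R < ‖x i‖) →
        x ∈ Set.univ.pi fun _ : Fin (k + 1) =>
          Metric.closedBall (0 : EuclideanSpace ℝ (Fin d)) R := by
    intro x hx
    push Not at hx
    simpa using hx
  have hzK := hin z fun h => (hout z h).not_gt (hzz ▸ haε)
  obtain ⟨x, -, hx⟩ := (isCompact_univ_pi fun _ : Fin (k + 1) =>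
    isCompact_closedBall (0 : EuclideanSpace ℝ (Fin d)) R).exists_isMaxOn ⟨z, hzK⟩
    (continuous_totalGain (k + 1) hφ).continuousOn
  have hmax : ∀ y, totalGain (k + 1) φ y ≤ totalGain (k + 1) φ x := by
    intro y
    by_cases hy : ∃ i, R < ‖y i‖
    · exact (hout y hy).trans (haε.le.trans (hzz ▸ hx hzK))
    · exact hx (hin y hy)
  have hax : (a : EReal) ≤ totalGain (k + 1) φ x := hzz ▸ hmax z
  have hxc : coulombCost (k + 1) x ≠ ⊤ := by
    intro h
    simp [totalGain, h] at hax
  have hxx := totalGain_eq_coe (φ := φ) hxc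
  rw [hxx, EReal.coe_le_coe_iff] at hax
  refine ⟨_, by linarith, ⟨x, hxx⟩, fun y => hxx ▸ hmax y, ε, hε0, R, fun y hy => ?_⟩
  exact (hout y hy).trans (EReal.coe_le_coe_iff.2 (by linarith))

/-- Attainment of the supremum of the total gain of `k` points for every `k ≤ n`. -/
lemma exists_max_totalGain {n : ℕ} {φ : EuclideanSpace ℝ (Fin d) → ℝ} (hφ : Continuous φ)
    (hφ0 : Tendsto φ (Bornology.cobounded (EuclideanSpace ℝ (Fin d))) (𝓝 0))
    {c : ℝ} (hc : (n : ℝ) < c)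
    (hfreq : ∃ᶠ y in Bornology.cobounded (EuclideanSpace ℝ (Fin d)), c < ‖y‖ * φ y) :
    ∀ k ≤ n, ∃ m : ℝ, (∃ x, totalGain k φ x = m) ∧ ∀ x, totalGain k φ x ≤ m := by
  intro k
  induction k with
  | zero => exact fun _ => ⟨0, ⟨0, by simp [totalGain, coulombCost]⟩,
      fun x => by simp [totalGain, coulombCost]⟩
  | succ k ih =>
    intro hk
    obtain ⟨m, ⟨x, hx⟩, hm⟩ := ih (by omega)
    have hkc : (k : ℝ) < c := lt_of_le_of_lt (by exact_mod_cast (by omega : k ≤ n)) hc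
    obtain ⟨m', -, h1, h2, -⟩ :=
      exists_max_totalGain_succ hφ hφ0 hm (exists_cons_totalGain_gt hkc hfreq hx)
    exact ⟨m', h1, h2⟩

/-! ### Empirical measures and weak duality -/

/-- The empirical measure `(1/N) ∑ δ_{x_i}`. -/
noncomputable def empiricalMeasure (N : ℕ) {X : Type*} [MeasurableSpace X] (x : Fin N → X) :
    Measure X :=
  (N : ℝ≥0∞)⁻¹ • ∑ i, Measure.dirac (x i)

lemma isProbabilityMeasure_empiricalMeasure {N : ℕ} (hN : N ≠ 0) {X : Type*} [MeasurableSpace X]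
    (x : Fin N → X) : IsProbabilityMeasure (empiricalMeasure N x) := by
  constructor
  simp [empiricalMeasure, ENNReal.inv_mul_cancel, hN]

lemma integral_empiricalMeasure {N : ℕ} {X : Type*} [TopologicalSpace X]
    [MeasurableSpace X] [BorelSpace X] (x : Fin N → X) {f : X → ℝ} (hf : Continuous f) :
    ∫ y, f y ∂(empiricalMeasure N x) = (N : ℝ)⁻¹ * ∑ i, f (x i) := by
  have hd : ∀ i, Integrable f (Measure.dirac (x i)) := fun i =>
    integrable_dirac' hf.stronglyMeasurable enorm_lt_top
  rw [empiricalMeasure, integral_smul_measure, integral_finsetSum_measure fun i _ => hd i]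
  simp [integral_dirac' _ _ hf.stronglyMeasurable]

/-- The empirical measure of a configuration is transported by the plan that is uniform on the
cyclic shifts of the configuration. -/
lemma transportCost_empiricalMeasure_le {N : ℕ} (hN : N ≠ 0)
    (x : Fin N → EuclideanSpace ℝ (Fin d)) :
    transportCost N (empiricalMeasure N x) ≤ coulombCost N x := by
  have : NeZero N := ⟨hN⟩
  set P : Measure (Fin N → EuclideanSpace ℝ (Fin d)) :=
    empiricalMeasure N fun s i => x (s + i) with hP
  have hmem : P ∈ transportPlans N (empiricalMeasure N x) := by
    refine ⟨isProbabilityMeasure_empiricalMeasure hN _, fun i => ?_⟩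
    have hi : Measurable fun y : Fin N → EuclideanSpace ℝ (Fin d) => y i := measurable_pi_apply i
    rw [hP, empiricalMeasure, Measure.map_smul, ← Measure.mapₗ_apply_of_measurable hi, map_sum]
    simp only [Measure.mapₗ_apply_of_measurable hi, Measure.map_dirac' hi]
    rw [empiricalMeasure, ← Equiv.sum_comp (Equiv.addRight i) fun j => Measure.dirac (x j)]
    rfl
  refine (iInf₂_le P hmem).trans (le_of_eq ?_)
  have hcost : ∀ s : Fin N, coulombCost N (fun i => x (s + i)) = coulombCost N x := fun s =>
    coulombCost_comp_equiv N (Equiv.addLeft s) x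
  rw [hP, empiricalMeasure, lintegral_smul_measure, lintegral_finsetSum_measure]
  simp only [lintegral_dirac' _ (continuous_coulombCost N).measurable, hcost]
  rw [Finset.sum_const, Finset.card_univ, Fintype.card_fin, nsmul_eq_mul, smul_eq_mul,
    ← mul_assoc, ENNReal.inv_mul_cancel (by simpa using hN) (by simp), one_mul]

lemma relaxedCost_le_transportCost (N : ℕ) (ρ : Measure (EuclideanSpace ℝ (Fin d)))
    [IsProbabilityMeasure ρ] : relaxedCost N ρ ≤ transportCost N ρ :=
  sInf_le ⟨fun _ => ρ, fun _ => inferInstance, fun _ => tendsto_const_nhds, by simp⟩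

lemma ofReal_integral_le_lintegral {X : Type*} [MeasurableSpace X] {μ : Measure X} {f : X → ℝ}
    (hf : Integrable f μ) : ENNReal.ofReal (∫ x, f x ∂μ) ≤ ∫⁻ x, ENNReal.ofReal (f x) ∂μ := by
  calc ENNReal.ofReal (∫ x, f x ∂μ) ≤ ENNReal.ofReal (∫ x, max (f x) 0 ∂μ) :=
        ENNReal.ofReal_le_ofReal (integral_mono hf hf.pos_part fun x => le_max_left _ _)
    _ = ∫⁻ x, ENNReal.ofReal (max (f x) 0) ∂μ :=
        ofReal_integral_eq_lintegral_ofReal hf.pos_part (ae_of_all _ fun x => le_max_right _ _)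
    _ = ∫⁻ x, ENNReal.ofReal (f x) ∂μ := by simp [ENNReal.ofReal_max]

lemma integrable_zeroAtInfty (g : C₀(EuclideanSpace ℝ (Fin d), ℝ))
    (μ : Measure (EuclideanSpace ℝ (Fin d))) [IsFiniteMeasure μ] : Integrable g μ :=
  g.toBCF.integrable μ

/-- The easy half of Kantorovich duality. -/
lemma ofReal_integral_sub_le_transportCost {N : ℕ} (hN : N ≠ 0)
    (g : C₀(EuclideanSpace ℝ (Fin d), ℝ)) {b : ℝ}
    (hg : ∀ x, totalGain N (fun y => (N : ℝ)⁻¹ * g y) x ≤ (b : EReal))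
    (ρ : Measure (EuclideanSpace ℝ (Fin d))) [IsProbabilityMeasure ρ] :
    ENNReal.ofReal (∫ y, g y ∂ρ - b) ≤ transportCost N ρ := by
  refine le_iInf₂ fun P hP => ?_
  obtain ⟨hP1, hPρ⟩ := hP
  have hint : ∀ i : Fin N, Integrable (fun x : Fin N → EuclideanSpace ℝ (Fin d) => g (x i)) P := by
    intro i
    have h := integrable_zeroAtInfty g ρ
    rw [← hPρ i] at h
    exact h.comp_measurable (measurable_pi_apply i)
  have heval : ∀ i : Fin N, ∫ x, g (x i) ∂P = ∫ y, g y ∂ρ := by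
    intro i
    rw [← hPρ i, integral_map (measurable_pi_apply i).aemeasurable
      g.continuous.aestronglyMeasurable]
  have hint' : ∀ i : Fin N, Integrable
      (fun x : Fin N → EuclideanSpace ℝ (Fin d) => (N : ℝ)⁻¹ * g (x i)) P :=
    fun i => (hint i).const_mul _
  have hsum := integrable_finsetSum Finset.univ fun i _ => hint' i
  have hI : ∫ x, (∑ i, (N : ℝ)⁻¹ * g (x i) - b) ∂P = ∫ y, g y ∂ρ - b := by
    rw [integral_sub hsum (integrable_const b), integral_finsetSum _ fun i _ => hint' i]
    simp only [integral_const_mul, heval]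
    have : (N : ℝ) ≠ 0 := Nat.cast_ne_zero.2 hN
    simp [this]
  rw [← hI]
  exact (ofReal_integral_le_lintegral (hsum.sub (integrable_const b))).trans
    (lintegral_mono fun x => (coe_sub_coe_le_iff _ _ _).1 (hg x))

lemma ofReal_integral_sub_le_relaxedCost {N : ℕ} (hN : N ≠ 0)
    (g : C₀(EuclideanSpace ℝ (Fin d), ℝ)) {b : ℝ}
    (hg : ∀ x, totalGain N (fun y => (N : ℝ)⁻¹ * g y) x ≤ (b : EReal))
    (ρ : Measure (EuclideanSpace ℝ (Fin d))) :
    ENNReal.ofReal (∫ y, g y ∂ρ - b) ≤ relaxedCost N ρ := by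
  refine le_sInf ?_
  rintro a ⟨ρs, hρs, hlim, rfl⟩
  have h : Tendsto (fun n => ENNReal.ofReal (∫ y, g y ∂(ρs n) - b)) atTop
      (𝓝 (ENNReal.ofReal (∫ y, g y ∂ρ - b))) :=
    (ENNReal.continuous_ofReal.tendsto _).comp ((hlim g).sub_const b)
  rw [← h.liminf_eq]
  exact liminf_le_liminf (Eventually.of_forall fun n =>
    have := hρs n
    ofReal_integral_sub_le_transportCost hN g hg (ρs n))

/-! ### Mass loss is not optimal -/

/-- A continuous cutoff: equal to `1` on the closed ball of radius `R`, with values in `[0, 1]`. -/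
lemma exists_zeroAtInfty_cutoff (R : ℝ) : ∃ f : C₀(EuclideanSpace ℝ (Fin d), ℝ),
    (∀ y, ‖y‖ ≤ R → f y = 1) ∧ ∀ y, 0 ≤ f y ∧ f y ≤ 1 := by
  obtain ⟨f, hf1, -, hfc, hf01⟩ := exists_continuous_one_zero_of_isCompact
    (isCompact_closedBall (0 : EuclideanSpace ℝ (Fin d)) R) isClosed_empty
    (Set.disjoint_empty _)
  exact ⟨⟨f, hfc.is_zero_at_infty⟩, fun y hy => hf1 (by simpa using hy),
    fun y => ⟨(hf01 y).1, (hf01 y).2⟩⟩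

/-- If unbounded configurations are not optimal for the total gain, then every sub-probability
of mass less than `1` has a relaxed energy above the optimal value. -/
lemma lt_relaxedEnergy {N : ℕ} (hN : N ≠ 0) (V : C₀(EuclideanSpace ℝ (Fin d), ℝ)) {m η R : ℝ}
    (hm : ∀ x, totalGain N (fun y => (N : ℝ)⁻¹ * V y) x ≤ m) (hη : 0 < η)
    (hR : ∀ x : Fin N → EuclideanSpace ℝ (Fin d), (∃ i, R < ‖x i‖) →
      totalGain N (fun y => (N : ℝ)⁻¹ * V y) x ≤ ((m - η : ℝ) : EReal))
    {ρ : Measure (EuclideanSpace ℝ (Fin d))} (hρ : ρ Set.univ < 1) :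
    ((-m : ℝ) : EReal) < relaxedEnergy N V ρ := by
  have : IsFiniteMeasure ρ := ⟨hρ.trans ENNReal.one_lt_top⟩
  have hN' : (N : ℝ) ≠ 0 := Nat.cast_ne_zero.2 hN
  obtain ⟨f, hf1, hf01⟩ := exists_zeroAtInfty_cutoff (d := d) R
  -- Inside the ball the cutoff averages to 1 and costs exactly η; outside, the deficit η is already
  -- in `hR`.
  have hg : ∀ x, totalGain N (fun y => (N : ℝ)⁻¹ * (V - η • f) y) x ≤ ((m - η : ℝ) : EReal) := by
    intro x
    refine (coe_sub_coe_le_iff _ _ _).2 ?_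
    have hs : ∑ i, (N : ℝ)⁻¹ * (V - η • f) (x i) =
        ∑ i, (N : ℝ)⁻¹ * V (x i) - η * ∑ i, (N : ℝ)⁻¹ * f (x i) := by
      rw [Finset.mul_sum, ← Finset.sum_sub_distrib]
      refine Finset.sum_congr rfl fun i _ => ?_
      simp only [ZeroAtInftyContinuousMap.sub_apply, ZeroAtInftyContinuousMap.smul_apply,
        smul_eq_mul]
      ring
    rw [hs]
    by_cases hx : ∃ i, R < ‖x i‖
    · refine le_trans (ENNReal.ofReal_le_ofReal ?_) ((coe_sub_coe_le_iff _ _ _).1 (hR x hx))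
      have : 0 ≤ η * ∑ i, (N : ℝ)⁻¹ * f (x i) :=
        mul_nonneg hη.le (Finset.sum_nonneg fun i _ => mul_nonneg (by positivity) (hf01 _).1)
      linarith
    · push Not at hx
      refine le_trans (ENNReal.ofReal_le_ofReal ?_) ((coe_sub_coe_le_iff _ _ _).1 (hm x))
      have : ∑ i, (N : ℝ)⁻¹ * f (x i) = 1 := by
        simp [hf1 _ (hx _), hN']
      rw [this]
      linarith
  have hle := ofReal_integral_sub_le_relaxedCost hN (V - η • f) hg ρ
  have hgi : ∫ y, (V - η • f) y ∂ρ = ∫ y, V y ∂ρ - η * ∫ y, f y ∂ρ := by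
    simp only [ZeroAtInftyContinuousMap.sub_apply, ZeroAtInftyContinuousMap.smul_apply,
      smul_eq_mul]
    rw [integral_sub (integrable_zeroAtInfty V ρ) ((integrable_zeroAtInfty f ρ).const_mul η),
      integral_const_mul]
  have hf : ∫ y, f y ∂ρ < 1 := by
    calc ∫ y, f y ∂ρ ≤ ∫ _, (1 : ℝ) ∂ρ :=
          integral_mono (integrable_zeroAtInfty f ρ) (integrable_const _) fun y => (hf01 y).2
      _ = ρ.real Set.univ := by simp
      _ < 1 := by
          have := (ENNReal.toReal_lt_toReal hρ.ne_top ENNReal.one_ne_top).2 hρ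
          simpa [Measure.real] using this
  rw [hgi] at hle
  by_contra! hcon
  unfold relaxedEnergy at hcon
  cases hc : relaxedCost N ρ with
  | top => rw [hc] at hcon; simp at hcon
  | coe c =>
    rw [hc, ENNReal.ofReal_le_iff_le_toReal ENNReal.coe_ne_top, ENNReal.coe_toReal] at hle
    rw [hc] at hcon
    change ((c : ℝ) : EReal) - _ ≤ _ at hcon
    rw [← EReal.coe_sub, EReal.coe_le_coe_iff] at hcon
    -- The two bounds on `c` force η(1 - ∫ f dρ) ≤ 0, against ∫ f dρ < 1.
    nlinarith

lemma relaxedEnergy_empiricalMeasure_le {N : ℕ} (hN : N ≠ 0)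
    (V : C₀(EuclideanSpace ℝ (Fin d), ℝ)) {m : ℝ} {x : Fin N → EuclideanSpace ℝ (Fin d)}
    (hx : totalGain N (fun y => (N : ℝ)⁻¹ * V y) x = m) :
    relaxedEnergy N V (empiricalMeasure N x) ≤ ((-m : ℝ) : EReal) := by
  have := isProbabilityMeasure_empiricalMeasure hN x
  have hxc := coulombCost_ne_top_of_totalGain_eq hx
  rw [totalGain_eq_coe hxc, EReal.coe_eq_coe_iff] at hx
  have hle := (relaxedCost_le_transportCost N _).trans (transportCost_empiricalMeasure_le hN x)
  refine (EReal.sub_le_sub (EReal.coe_ennreal_le_coe_ennreal_iff.2 hle) le_rfl).trans ?_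
  rw [integral_empiricalMeasure x (map_continuous V), ← EReal.coe_ennreal_toReal hxc, ← EReal.coe_sub,
    EReal.coe_le_coe_iff, Finset.mul_sum]
  linarith

end RelaxedCoulomb

open RelaxedCoulomb in
theorem mainTheorem10 (d N : ℕ) (hd : 1 ≤ d) (hN : 1 ≤ N)
    (V : ZeroAtInftyContinuousMap (EuclideanSpace ℝ (Fin d)) ℝ) (hV : ∀ x, 0 ≤ V x)
    (hpos : 0 < RelaxedCoulomb.decayRate V)
    (hβ : (((N : ℝ) * ((N : ℝ) - 1) : ℝ) : EReal) < RelaxedCoulomb.decayRate V) :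
    RelaxedCoulomb.M (N - 1) (fun x => ((N : ℝ) - 1) / (N : ℝ) * V x)
        < RelaxedCoulomb.M N (fun x => V x) ∧
      (∀ ρ ∈ RelaxedCoulomb.relaxedMinimizers N V, MeasureTheory.IsProbabilityMeasure ρ) ∧
      (∃ x : Fin N → EuclideanSpace ℝ (Fin d),
        RelaxedCoulomb.gain N (fun x => V x) x = RelaxedCoulomb.M N (fun x => V x)) := by
  obtain ⟨k, rfl⟩ : ∃ k, N = k + 1 := ⟨N - 1, by omega⟩
  have hN0 : (0 : ℝ) < ((k + 1 : ℕ) : ℝ) := by positivity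
  set φ : EuclideanSpace ℝ (Fin d) → ℝ := fun y => ((k + 1 : ℕ) : ℝ)⁻¹ * V y with hφdef
  have hφ : Continuous φ := continuous_const.mul V.continuous
  have hφ0 : Tendsto φ (Bornology.cobounded (EuclideanSpace ℝ (Fin d))) (𝓝 0) := by
    have h := V.zero_at_infty'
    rw [← Metric.cobounded_eq_cocompact] at h
    simpa [hφdef] using h.const_mul ((k + 1 : ℕ) : ℝ)⁻¹
  obtain ⟨b, hb1, hb2⟩ := EReal.lt_iff_exists_real_btwn.1 hβ
  rw [EReal.coe_lt_coe_iff] at hb1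
  -- Dividing b > N(N-1) by N leaves exactly the N - 1 = k charges to be overcome.
  have hc : (k : ℝ) < ((k + 1 : ℕ) : ℝ)⁻¹ * b := by
    rw [lt_inv_mul_iff₀ hN0]
    push_cast at hb1 ⊢
    linarith
  have hfreq : ∃ᶠ y in Bornology.cobounded (EuclideanSpace ℝ (Fin d)),
      ((k + 1 : ℕ) : ℝ)⁻¹ * b < ‖y‖ * φ y := by
    refine (frequently_lt_of_lt_limsup (by isBoundedDefault) hb2).mono fun y hy => ?_
    rw [EReal.coe_lt_coe_iff] at hy
    rw [hφdef, mul_left_comm]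
    exact mul_lt_mul_of_pos_left hy (by positivity)
  obtain ⟨m, ⟨x, hx⟩, hm⟩ := exists_max_totalGain hφ hφ0 hc hfreq k le_rfl
  obtain ⟨m', hmm', ⟨x', hx'⟩, hm', η, hη, R, hR⟩ :=
    exists_max_totalGain_succ hφ hφ0 hm (exists_cons_totalGain_gt hc hfreq hx)
  have hgain : ∀ z, gain (k + 1) (fun y => V y) z = totalGain (k + 1) φ z := fun z => by
    simpa [hφdef] using gain_mul_eq_totalGain (k + 1) 1 ((k + 1 : ℕ) : ℝ)⁻¹ (Or.inl (by simp)) V z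
  have hgain' : ∀ z, gain k (fun y => (((k + 1 : ℕ) : ℝ) - 1) / ((k + 1 : ℕ) : ℝ) * V y) z =
      totalGain k φ z := fun z => by
    refine gain_mul_eq_totalGain k _ _ ?_ V z
    rcases Nat.eq_zero_or_pos k with h | h
    · exact Or.inr h
    · left
      have : (k : ℝ) ≠ 0 := by positivity
      push_cast
      field_simp
      ring
  have hM : M (k + 1) (fun y => V y) = (m' : EReal) :=
    le_antisymm (iSup_le fun z => hgain z ▸ hm' z) (hx' ▸ hgain x' ▸ le_iSup _ x')
  have hM' : M k (fun y => (((k + 1 : ℕ) : ℝ) - 1) / ((k + 1 : ℕ) : ℝ) * V y) ≤ (m : EReal) :=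
    iSup_le fun z => hgain' z ▸ hm z
  refine ⟨?_, ?_, x', ?_⟩
  · rw [hM]
    exact hM'.trans_lt (EReal.coe_lt_coe_iff.2 hmm')
  · rintro ρ ⟨hρ1, hρ⟩
    refine ⟨le_antisymm hρ1 (not_lt.1 fun hlt => ?_)⟩
    have hp := isProbabilityMeasure_empiricalMeasure k.succ_ne_zero x'
    have h1 := lt_relaxedEnergy k.succ_ne_zero V hm' hη hR hlt
    have h2 := relaxedEnergy_empiricalMeasure_le k.succ_ne_zero V hx'
    exact absurd (h1.trans_le ((hρ _ hp.measure_univ.le).trans h2)) (lt_irrefl _)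
  · rw [hM, hgain, hx']
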